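/- Let $G$ be a countably infinite (discrete) amenable group acting continuously on a compact metrizable space $X$. Then every mean dimension pair of the action is an SBP pair. Here the terms are defined as follows. For a finite open cover $\mathcal U$ of $X$, let $\mathcal D(\mathcal U)$ be the minimum, over all finite open covers $\mathcal V$ of $X$ refining $\mathcal U$, of $\max_{x\in X}\sum_{V\in\mathcal V}1_V(x)-1$. For a nonempty finite set $F\subseteq G$ write $\mathcal U^F=\bigvee_{s\in F}s^{-1}\mathcal U$. Put $$\mathrm{mdim}(\mathcal U)=\lim_F \frac{\mathcal D(\mathcal U^F)}{|F|},$$ where the limit is taken as the nonempty finite set $F\subseteq G$ becomes more and more left invariant, i.e. as $|gF\,\triangle\,F|/|F|\to 0$ for every $g\in G$ (the limit exists, hence equals the corresponding upper limit). A pair $(x_1,x_2)\in X^2$ with $x_1\neq x_2$ is a *mean dimension pair* if $\mathrm{mdim}(\{X\setminus A_1,X\setminus A_2\})>0$ for all disjoint closed neighbourhoods $A_1$ of $x_1$ and $A_2$ of $x_2$. A pair $(x_1,x_2)\in X^2$ with $x_1\neq x_2$ is an *SBP pair* if there is no open neighbourhood $U$ of $x_1$ such that $x_2\notin\overline U$ and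 $\mu(\partial U)=0$ for every $G$-invariant Borel probability measure $\mu$ on $X$. -/

import Mathlib

open MeasureTheory Filter Set
open scoped ENNReal Topology

namespace SmallBoundary

section Amenability

/-- The filter on the finite subsets of the discrete group `G` expressing that `F` becomes more
and more left invariant: a property holds eventually along this filter iff there are a finite
`K ⊆ G` and `ε > 0` such that it holds for all nonempty finite `F ⊆ G` with
`|gF ∆ F| < ε |F|` for every `g ∈ K`. -/
noncomputable def folnerFilter (G : Type*) [Group G] : Filter (Finset G) :=
  letI : MeasurableSpace G := ⊤
  comap (fun F : Finset G => (F : Set G)) (maxFoelner G (Measure.count : Measure G))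

/-- Amenability of the discrete group `G` (Følner condition): there exist nonempty finite subsets
of `G` that are arbitrarily close to being left invariant under any given finite set. -/
def IsAmenable (G : Type*) [Group G] : Prop :=
  (folnerFilter G).NeBot

end Amenability

section MeanDimension

variable {X : Type*}

/-- `𝒱` is a finite open cover of `X`. -/
structure IsFiniteOpenCover [TopologicalSpace X] (𝒱 : Set (Set X)) : Prop where
  finite : 𝒱.Finite
  isOpen : ∀ V ∈ 𝒱, IsOpen V
  cover : ⋃₀ 𝒱 = univ

/-- `𝒱` refines `𝒰`: every member of `𝒱` is contained in some member of `𝒰`. -/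
def Refines (𝒱 𝒰 : Set (Set X)) : Prop :=
  ∀ V ∈ 𝒱, ∃ U ∈ 𝒰, V ⊆ U

/-- `𝒟(𝒰) = min_𝒱 ord(𝒱)`, where `𝒱` ranges over the finite open covers of `X` refining `𝒰` and
`ord(𝒱) = max_{x ∈ X} ∑_{V ∈ 𝒱} 1_V(x) - 1`. It is written as the least `d` such that some such
`𝒱` has `ord(𝒱) ≤ d`, i.e. such that every point lies in at most `d + 1` members of `𝒱`. -/
noncomputable def coverDim [TopologicalSpace X] (𝒰 : Set (Set X)) : ℕ :=
  sInf {d : ℕ | ∃ 𝒱 : Set (Set X), IsFiniteOpenCover 𝒱 ∧ Refines 𝒱 𝒰 ∧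
    ∀ x : X, {V ∈ 𝒱 | x ∈ V}.ncard ≤ d + 1}

/-- The join `𝒰^F = ⋁_{s ∈ F} s⁻¹𝒰`, whose members are the sets `⋂_{s ∈ F} s⁻¹ U_s` with
`U_s ∈ 𝒰`. -/
def joinCover {G : Type*} [Group G] [MulAction G X] (𝒰 : Set (Set X)) (F : Finset G) :
    Set (Set X) :=
  {W | ∃ u : G → Set X, (∀ s ∈ F, u s ∈ 𝒰) ∧ W = ⋂ s ∈ F, (fun x : X => s • x) ⁻¹' u s}

/-- The mean dimension `mdim(𝒰) = lim_F 𝒟(𝒰^F) / |F|` of a finite open cover `𝒰` of `X`, the limit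
being taken as the nonempty finite set `F ⊆ G` becomes more and more left invariant. For amenable
`G` the limit exists (Ornstein–Weiss), so that it is the upper limit used here. -/
noncomputable def mdimCover (G : Type*) [Group G] [TopologicalSpace X] [MulAction G X]
    (𝒰 : Set (Set X)) : ℝ≥0∞ :=
  limsup (fun F : Finset G => (coverDim (joinCover 𝒰 F) : ℝ≥0∞) / (F.card : ℝ≥0∞))
    (folnerFilter G)

/-- A pair of distinct points is a mean dimension pair if `mdim({X \ A₁, X \ A₂}) > 0` for all
disjoint closed neighbourhoods `A₁` of `x₁` and `A₂` of `x₂`. -/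
def IsMeanDimensionPair (G : Type*) [Group G] [TopologicalSpace X] [MulAction G X]
    (x₁ x₂ : X) : Prop :=
  x₁ ≠ x₂ ∧ ∀ A₁ A₂ : Set X, IsClosed A₁ → IsClosed A₂ → A₁ ∈ 𝓝 x₁ → A₂ ∈ 𝓝 x₂ →
    Disjoint A₁ A₂ → 0 < mdimCover G ({A₁ᶜ, A₂ᶜ} : Set (Set X))

end MeanDimension

section SmallBoundaryPairs

variable {X : Type*} [MeasurableSpace X]

/-- The set `ℳ_G(X)` of `G`-invariant (Borel) probability measures on `X`. -/
def invariantMeasures (G X : Type*) [Group G] [MulAction G X] [MeasurableSpace X] :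
    Set (ProbabilityMeasure X) :=
  {μ | SMulInvariantMeasure G X (μ : Measure X)}

/-- A Borel set `Y` is `𝒩`-small if `sup_{μ ∈ 𝒩} μ(Y) = 0`. -/
def IsSmall (𝒩 : Set (ProbabilityMeasure X)) (Y : Set X) : Prop :=
  MeasurableSet Y ∧ (⨆ μ ∈ 𝒩, (μ : Measure X) Y) = 0

/-- A pair of distinct points is an SBP pair if there is no open neighbourhood `U` of `x₁` with
`x₂ ∉ closure U` whose boundary is `ℳ_G(X)`-small. -/
def IsSBPPair (G : Type*) [Group G] [TopologicalSpace X] [MulAction G X] (x₁ x₂ : X) : Prop :=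
  x₁ ≠ x₂ ∧ ¬ ∃ U : Set X, IsOpen U ∧ x₁ ∈ U ∧ x₂ ∉ closure U ∧
    IsSmall (invariantMeasures G X) (frontier U)

end SmallBoundaryPairs

end SmallBoundary

/-! The argument is by contraposition. Suppose an open `U` around `x₁`, with `x₂` outside its
closure, has boundary null for every invariant measure. Limits of empirical measures along Følner
sets are invariant, so by compactness some open `W ⊇ frontier U` is visited by every orbit with
frequency at most `ε` (`exists_isOpen_eventually_card_le`).

Urysohn's lemma gives `f : X → [0, 1]`, equal to `0` on `closure U \ W` and to `1` on `Uᶜ \ W`, so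
that `0 < f < 1` only inside `W`. Then `x ↦ (f (s • x))_{s ∈ F}` sends `X` into the skeleton of
dimension at most `ε |F|` of the cube `[0, 1]^F`. Pulling back the open stars of the barycentric
subdivision bounds the cover dimension by `ε |F|` (`coverDim_joinCover_le`). Hence the mean
dimension of the cover vanishes (`mdimCover_eq_zero`). -/

namespace SmallBoundary

/-! ### Følner sets -/

section Folner

variable {G : Type*} [Group G]

open scoped Pointwise symmDiff in
/-- The finite sets form a Følner family along `folnerFilter G`. -/
theorem isFoelner_folnerFilter (G : Type*) [Group G] :
    letI : MeasurableSpace G := ⊤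
    IsFoelner G (Measure.count : Measure G) (folnerFilter G) (fun F : Finset G => (F : Set G)) := by
  let : MeasurableSpace G := ⊤
  exact (isFoelner_iff_tendsto _ _).2 tendsto_comap

theorem eventually_nonempty_folnerFilter : ∀ᶠ F in folnerFilter G, F.Nonempty := by
  let : MeasurableSpace G := ⊤
  filter_upwards [(isFoelner_folnerFilter G).eventually_meas_ne_zero] with F hF
  rw [Finset.nonempty_iff_ne_empty]
  rintro rfl
  simp at hF

open Classical in
open scoped Pointwise symmDiff in
theorem tendsto_card_symmDiff_div_card (g : G) :
    Tendsto (fun F : Finset G => ((symmDiff (F.image (g * ·)) F).card : ℝ) / F.card)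
      (folnerFilter G) (𝓝 0) := by
  let : MeasurableSpace G := ⊤
  have h := (isFoelner_folnerFilter G).tendsto_meas_smul_symmDiff g
  have h2 := (ENNReal.tendsto_toReal ENNReal.zero_ne_top).comp h
  simp only [ENNReal.toReal_zero] at h2
  refine h2.congr fun F => ?_
  have hS : (g • (F : Set G)) ∆ (F : Set G)
      = ((symmDiff (F.image (g * ·)) F : Finset G) : Set G) := by
    ext x
    have h1 : x ∈ g • (F : Set G) ↔ x ∈ F.image (g * ·) := by
      rw [← Set.image_smul]
      simp
    rw [Set.mem_symmDiff, Finset.mem_coe, Finset.mem_coe, Finset.mem_symmDiff, h1]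
  simp only [Function.comp_apply]
  rw [hS, Measure.count_apply_finset, Measure.count_apply_finset]
  simp

end Folner

/-! ### Empirical measures and their invariant limits -/

section Empirical

variable {G X : Type*} [Group G] [MulAction G X] [MeasurableSpace X]

open Classical in
/-- The uniform distribution on the piece `{s • x | s ∈ F}` of the orbit of `x`
(the Dirac measure at `x` for empty `F`). -/
noncomputable def empiricalMeasure (F : Finset G) (x : X) : ProbabilityMeasure X :=
  if h : F.Nonempty then
    ⟨(F.card : ℝ≥0∞)⁻¹ • ∑ s ∈ F, Measure.dirac (s • x), ⟨by
      simp [ENNReal.inv_mul_cancel, h.ne_empty]⟩⟩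
  else ⟨Measure.dirac x, inferInstance⟩

theorem toMeasure_empiricalMeasure {F : Finset G} (h : F.Nonempty) (x : X) :
    (empiricalMeasure F x : Measure X) = (F.card : ℝ≥0∞)⁻¹ • ∑ s ∈ F, Measure.dirac (s • x) := by
  simp [empiricalMeasure, h]

open Classical in
theorem empiricalMeasure_apply {F : Finset G} (h : F.Nonempty) (x : X) {C : Set X}
    (hC : MeasurableSet C) :
    (empiricalMeasure F x : Measure X) C
      = ((F.filter fun s => s • x ∈ C).card : ℝ≥0∞) / F.card := by
  rw [toMeasure_empiricalMeasure h, Measure.smul_apply, Measure.finsetSum_apply,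
    div_eq_mul_inv, mul_comm, smul_eq_mul]
  simp [Measure.dirac_apply' _ hC, Set.indicator_apply]

theorem integral_empiricalMeasure {F : Finset G} (h : F.Nonempty) (x : X) {f : X → ℝ}
    (hf : StronglyMeasurable f) :
    ∫ y, f y ∂(empiricalMeasure F x : Measure X) = (∑ s ∈ F, f (s • x)) / F.card := by
  rw [toMeasure_empiricalMeasure h, integral_smul_measure, integral_finsetSum_measure]
  · simp [integral_dirac' _ _ hf, div_eq_inv_mul]
  · intro s _
    exact integrable_dirac' hf (by simp)

-- Translating by `g` is injective, so after cancelling common terms only the symmetric difference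
-- of `gF` and `F` contributes.
open Classical in
theorem abs_sum_mul_sub_sum_le (F : Finset G) (g : G) (φ : G → ℝ) {C : ℝ}
    (hφ : ∀ s, |φ s| ≤ C) :
    |∑ s ∈ F, φ (g * s) - ∑ s ∈ F, φ s| ≤ (symmDiff (F.image (g * ·)) F).card * C := by
  rw [← Finset.sum_image (f := φ) (g := fun s => g * s)
    (fun a _ b _ hab => mul_left_cancel hab), ← Finset.sum_sdiff_sub_sum_sdiff]
  have hd : Disjoint (F.image (g * ·) \ F) (F \ F.image (g * ·)) := disjoint_sdiff_sdiff
  calc _ ≤ |∑ s ∈ F.image (g * ·) \ F, φ s| + |∑ s ∈ F \ F.image (g * ·), φ s| := abs_sub _ _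
    _ ≤ ∑ s ∈ F.image (g * ·) \ F, |φ s| + ∑ s ∈ F \ F.image (g * ·), |φ s| :=
        add_le_add (Finset.abs_sum_le_sum_abs _ _) (Finset.abs_sum_le_sum_abs _ _)
    _ = ∑ s ∈ symmDiff (F.image (g * ·)) F, |φ s| := by
        rw [← Finset.sum_union hd]; rfl
    _ ≤ _ := by
        rw [← nsmul_eq_mul]
        exact Finset.sum_le_card_nsmul _ _ _ fun s _ => hφ s

variable [TopologicalSpace X] [TopologicalSpace.MetrizableSpace X] [BorelSpace X]
  [ContinuousConstSMul G X]

/-- Limits of empirical measures along Følner sets are invariant. -/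
theorem mem_invariantMeasures_of_tendsto {ι : Type*} {l : Filter ι} [l.NeBot]
    {F : ι → Finset G} {x : ι → X} (hF : Tendsto F l (folnerFilter G)) {μ : ProbabilityMeasure X}
    (hμ : Tendsto (fun i => empiricalMeasure (F i) (x i)) l (𝓝 μ)) :
    μ ∈ invariantMeasures G X := by
  classical
  have key : ∀ g : G, μ.map (continuous_const_smul g).measurable.aemeasurable = μ := by
    intro g
    have h1 := ProbabilityMeasure.tendsto_map_of_tendsto_of_continuous _ _ hμ
      (continuous_const_smul g)
    refine tendsto_nhds_unique h1 ?_
    rw [ProbabilityMeasure.tendsto_iff_forall_integral_tendsto] at hμ ⊢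
    intro f
    have hz : Tendsto (fun i => ((symmDiff ((F i).image (g * ·)) (F i)).card : ℝ) / (F i).card
        * ‖f‖) l (𝓝 0) := by
      simpa using ((tendsto_card_symmDiff_div_card g).comp hF).mul_const ‖f‖
    have hd : Tendsto (fun i =>
        ∫ y, f y ∂((empiricalMeasure (F i) (x i)).map
          (continuous_const_smul g).measurable.aemeasurable : Measure X)
        - ∫ y, f y ∂(empiricalMeasure (F i) (x i) : Measure X)) l (𝓝 0) := by
      refine squeeze_zero_norm' ?_ hz
      filter_upwards [hF.eventually eventually_nonempty_folnerFilter] with i hi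
      have hc : StronglyMeasurable fun y => f (g • y) :=
        (f.continuous.comp (continuous_const_smul g)).stronglyMeasurable
      rw [ProbabilityMeasure.toMeasure_map, integral_map
        (continuous_const_smul g).measurable.aemeasurable
        f.continuous.stronglyMeasurable.aestronglyMeasurable,
        integral_empiricalMeasure hi _ hc,
        integral_empiricalMeasure hi _ f.continuous.stronglyMeasurable, ← sub_div, norm_div,
        Real.norm_natCast, div_mul_eq_mul_div, Real.norm_eq_abs]
      gcongr
      have := abs_sum_mul_sub_sum_le (F i) g (fun s => f (s • x i)) (C := ‖f‖)
        fun s => f.norm_coe_le_norm _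
      simpa only [mul_smul] using this
    simpa using hd.add (hμ f)
  refine ⟨fun g s hs => ?_⟩
  have := congrArg (fun ν : ProbabilityMeasure X => (ν : Measure X) s) (key g)
  simpa [Measure.map_apply (continuous_const_smul g).measurable hs] using this

end Empirical

end SmallBoundary
namespace SmallBoundary

/-! ### Uniform visit frequencies near null closed sets -/

section OrbitCapacity

variable {G X : Type*} [Group G] [MulAction G X] [MeasurableSpace X]
  [TopologicalSpace X] [CompactSpace X] [TopologicalSpace.MetrizableSpace X] [BorelSpace X]
  [ContinuousConstSMul G X]

open Classical in
/-- A closed set that is null for all invariant measures has neighbourhoods which orbits visit with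
uniformly small frequency. -/
theorem exists_isOpen_eventually_card_le {E O : Set X} (hE : IsClosed E) (hO : IsOpen O)
    (hEO : E ⊆ O) (hnull : ∀ μ ∈ invariantMeasures G X, (μ : Measure X) E = 0)
    {ε : ℝ≥0∞} (hε : 0 < ε) :
    ∃ W, IsOpen W ∧ E ⊆ W ∧ W ⊆ O ∧ ∀ᶠ F in folnerFilter G, ∀ x : X,
      ((F.filter fun s : G => s • x ∈ W).card : ℝ≥0∞) ≤ ε * F.card := by
  let : MetricSpace X := TopologicalSpace.metrizableSpaceMetric X
  obtain ⟨δ, hδ, hδO⟩ := hE.isCompact.exists_cthickening_subset_open hO hEO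
  let r : ℕ → ℝ := fun n => δ / (n + 1)
  have hr : ∀ n, 0 < r n := fun n => by positivity
  have hrδ : ∀ n, r n ≤ δ := fun n => div_le_self hδ.le (by simp)
  have hr_anti : Antitone r := fun m n hmn => by
    dsimp only [r]; gcongr
  have hr0 : Tendsto r atTop (𝓝 0) :=
    Tendsto.div_atTop tendsto_const_nhds
      (tendsto_natCast_atTop_atTop.atTop_add tendsto_const_nhds)
  by_contra hcon
  push Not at hcon
  -- Closed thickenings and a non-strict inequality are used so that the bound passes to weak limits
  -- by the portmanteau theorem. Monotonicity in `n` lets one ultrafilter serve all radii.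
  let B : ℕ → Set (Finset G × X) := fun n =>
    {p | ε * p.1.card ≤ ((p.1.filter fun s : G => s • p.2 ∈ Metric.cthickening (r n) E).card : ℝ≥0∞)}
  let L : ℕ → Filter (Finset G × X) := fun n => comap Prod.fst (folnerFilter G) ⊓ 𝓟 (B n)
  have hB : Antitone B := by
    intro m n hmn p hp
    refine le_trans (show ε * p.1.card ≤ _ from hp) ?_
    gcongr
    exact Metric.cthickening_mono (hr_anti hmn) E
  have hL : ∀ n, (L n).NeBot := by
    intro n
    have h := hcon _ (Metric.isOpen_thickening (δ := r n) (E := E))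
      (Metric.self_subset_thickening (hr n) E)
      ((Metric.thickening_subset_cthickening _ _).trans
        ((Metric.cthickening_mono (hrδ n) E).trans hδO))
    rw [← frequently_mem_iff_neBot, frequently_comap]
    refine h.mono fun F ⟨x, hx⟩ => ⟨(F, x), rfl, hx.le.trans ?_⟩
    gcongr
    exact Metric.thickening_subset_cthickening _ _
  have hI : (⨅ n, L n).NeBot := by
    refine iInf_neBot_of_directed' (directed_of_isDirected_le fun m n hmn => ?_) hL
    exact inf_le_inf_left _ (principal_mono.2 (hB hmn))
  let 𝒰 := Ultrafilter.of (⨅ n, L n)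
  have h𝒰 : ∀ n, (𝒰 : Filter (Finset G × X)) ≤ L n := fun n =>
    (Ultrafilter.of_le _).trans (iInf_le _ n)
  have hfst : Tendsto Prod.fst (𝒰 : Filter (Finset G × X)) (folnerFilter G) :=
    tendsto_comap.mono_left ((h𝒰 0).trans inf_le_left)
  let m : Finset G × X → ProbabilityMeasure X := fun p => empiricalMeasure p.1 p.2
  obtain ⟨μ, -, hμ⟩ := isCompact_univ.ultrafilter_le_nhds (𝒰.map m) (by simp)
  have hμ : Tendsto m 𝒰 (𝓝 μ) := hμ
  have hinv := mem_invariantMeasures_of_tendsto hfst hμ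
  have hge : ∀ n, ε ≤ (μ : Measure X) (Metric.cthickening (r n) E) := by
    intro n
    refine le_trans ?_ (ProbabilityMeasure.limsup_measure_closed_le_of_tendsto hμ
      Metric.isClosed_cthickening)
    refine le_limsup_of_frequently_le (Eventually.frequently ?_)
    filter_upwards [hfst.eventually eventually_nonempty_folnerFilter,
      (h𝒰 n).trans inf_le_right (mem_principal_self _)] with p hp hpB
    rw [empiricalMeasure_apply hp _ Metric.isClosed_cthickening.measurableSet,
      ENNReal.le_div_iff_mul_le (by simp [hp.ne_empty]) (by simp)]
    exact hpB
  -- Shrinking the thickenings to `E` would give `ε ≤ μ E = 0`.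
  have hlim := (tendsto_measure_cthickening_of_isClosed (μ := (μ : Measure X))
    ⟨1, one_pos, measure_ne_top _ _⟩ hE).comp hr0
  have := ge_of_tendsto' hlim hge
  rw [hnull μ hinv] at this
  exact absurd this (not_le.2 hε)

end OrbitCapacity

/-! ### Star covers of cube skeleta -/

section CubeCover

variable {G X : Type*} [Group G] [MulAction G X]

/-- For `f : X → [0, 1]`, the set of points `x` at which the coordinates `f (s • x)`, `s ∈ S`, lie
strictly between `0` and `1` and strictly farther from `{0, 1}` than those with `s ∈ F \ S`, where
the latter are nearer to `1` for `s ∈ T` and nearer to `0` for `s ∉ T`. -/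
def cubeStar (f : X → ℝ) (F S T : Finset G) : Set X :=
  {x | (∀ s ∈ S, 0 < f (s • x) ∧ f (s • x) < 1) ∧
    ∀ r ∈ F, r ∉ S →
      (∀ s ∈ S, min (f (r • x)) (1 - f (r • x)) < min (f (s • x)) (1 - f (s • x))) ∧
      (r ∈ T → 1 / 2 < f (r • x)) ∧ (r ∉ T → f (r • x) < 1 / 2)}

theorem isOpen_cubeStar [TopologicalSpace X] [ContinuousConstSMul G X] {f : X → ℝ}
    (hf : Continuous f) (F S T : Finset G) : IsOpen (cubeStar f F S T) := by
  have hc : ∀ s : G, Continuous fun x : X => f (s • x) := fun s =>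
    hf.comp (continuous_const_smul s)
  have hm : ∀ s : G, Continuous fun x : X => min (f (s • x)) (1 - f (s • x)) := fun s =>
    (hc s).min (continuous_const.sub (hc s))
  have : cubeStar f F S T = (⋂ s ∈ S, {x | 0 < f (s • x)} ∩ {x | f (s • x) < 1}) ∩
      ⋂ r ∈ F, ⋂ (_ : r ∉ S),
        (⋂ s ∈ S, {x | min (f (r • x)) (1 - f (r • x)) < min (f (s • x)) (1 - f (s • x))}) ∩
        ((⋂ (_ : r ∈ T), {x | 1 / 2 < f (r • x)}) ∩ ⋂ (_ : r ∉ T), {x | f (r • x) < 1 / 2}) := by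
    ext x
    simp [cubeStar]
  rw [this]
  refine IsOpen.inter (isOpen_biInter_finset fun s _ => ?_)
    (isOpen_biInter_finset fun r _ => isOpen_iInter_of_finite fun _ => IsOpen.inter
      (isOpen_biInter_finset fun s _ => isOpen_lt (hm r) (hm s)) (IsOpen.inter
        (isOpen_iInter_of_finite fun _ => isOpen_lt continuous_const (hc r))
        (isOpen_iInter_of_finite fun _ => isOpen_lt (hc r) continuous_const)))
  exact (isOpen_lt continuous_const (hc s)).inter (isOpen_lt (hc s) continuous_const)

/-- `S` must consist of the coordinates farthest from `{0, 1}`, so its cardinality determines it;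
the remaining coordinates then determine `T` by rounding. -/
theorem cubeStar_index_eq_of_card_eq {f : X → ℝ} {F S₁ T₁ S₂ T₂ : Finset G} {x : X}
    (hS₁ : S₁ ⊆ F) (hS₂ : S₂ ⊆ F) (hT₁ : ∀ r ∈ T₁, r ∈ F ∧ r ∉ S₁) (hT₂ : ∀ r ∈ T₂, r ∈ F ∧ r ∉ S₂)
    (h₁ : x ∈ cubeStar f F S₁ T₁) (h₂ : x ∈ cubeStar f F S₂ T₂) (hcard : S₁.card = S₂.card) :
    S₁ = S₂ ∧ T₁ = T₂ := by
  have hS : S₁ = S₂ := by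
    by_cases hle : S₁ ⊆ S₂
    · exact Finset.eq_of_subset_of_card_le hle hcard.ge
    · refine (Finset.eq_of_subset_of_card_le (fun r hr => ?_) hcard.le).symm
      obtain ⟨s, hs₁, hs₂⟩ := Finset.not_subset.1 hle
      by_contra hr₁
      exact lt_asymm ((h₁.2 r (hS₂ hr) hr₁).1 s hs₁) ((h₂.2 s (hS₁ hs₁) hs₂).1 r hr)
  subst hS
  refine ⟨rfl, Finset.ext fun r => ⟨fun hr => ?_, fun hr => ?_⟩⟩
  · obtain ⟨hF, hS⟩ := hT₁ r hr
    by_contra hr₂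
    exact lt_asymm ((h₁.2 r hF hS).2.1 hr) ((h₂.2 r hF hS).2.2 hr₂)
  · obtain ⟨hF, hS⟩ := hT₂ r hr
    by_contra hr₁
    exact lt_asymm ((h₂.2 r hF hS).2.1 hr) ((h₁.2 r hF hS).2.2 hr₁)

-- The stars containing a point are distinguished by `S.card`. Since `S` lists only coordinates
-- strictly between `0` and `1`, this number lies in `{0, …, k}`, leaving at most `k + 1` stars.
open Classical in
theorem coverDim_joinCover_le [TopologicalSpace X] [ContinuousConstSMul G X] {f : X → ℝ}
    (hf : Continuous f) {A₁ A₂ : Set X} (h₁ : ∀ x ∈ A₁, f x = 0) (h₂ : ∀ x ∈ A₂, f x = 1)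
    (F : Finset G) {k : ℕ}
    (hk : ∀ x : X, (F.filter fun s => 0 < f (s • x) ∧ f (s • x) < 1).card ≤ k) :
    coverDim (joinCover ({A₁ᶜ, A₂ᶜ} : Set (Set X)) F) ≤ k := by
  let I : Finset (Finset G × Finset G) :=
    (F.powerset ×ˢ F.powerset).filter fun p => ∀ r ∈ p.2, r ∈ F ∧ r ∉ p.1
  refine Nat.sInf_le ⟨(fun p => cubeStar f F p.1 p.2) '' (I : Set (Finset G × Finset G)),
    ⟨I.finite_toSet.image _, ?_, ?_⟩, ?_, fun x => ?_⟩
  · rintro _ ⟨p, -, rfl⟩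
    exact isOpen_cubeStar hf _ _ _
  · rw [sUnion_image, eq_univ_iff_forall]
    intro x
    -- Any threshold in `(0, 1/2]` works: positivity keeps the coordinates in `S` off `{0, 1}`, and
    -- the upper bound keeps the others off `1/2`.
    let S := F.filter fun s => 1 / 4 ≤ min (f (s • x)) (1 - f (s • x))
    let T := F.filter fun r => r ∉ S ∧ 1 / 2 < f (r • x)
    refine mem_biUnion (x := (S, T)) ?_ ⟨fun s hs => ?_, fun r hr hrS => ⟨fun s hs => ?_, ?_, ?_⟩⟩
    · simp only [I, Finset.coe_filter, mem_ofPred_eq, Finset.mem_product, Finset.mem_powerset]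
      refine ⟨⟨Finset.filter_subset _ _, Finset.filter_subset _ _⟩, fun r hr => ?_⟩
      exact ⟨(Finset.mem_filter.1 hr).1, (Finset.mem_filter.1 hr).2.1⟩
    · have := le_min_iff.1 (Finset.mem_filter.1 hs).2
      constructor <;> linarith
    · have hr' : min (f (r • x)) (1 - f (r • x)) < 1 / 4 := by
        by_contra hc
        exact hrS (Finset.mem_filter.2 ⟨hr, not_lt.1 hc⟩)
      exact hr'.trans_le (Finset.mem_filter.1 hs).2
    · exact fun hT => (Finset.mem_filter.1 hT).2.2
    · intro hT
      have hle : f (r • x) ≤ 1 / 2 := by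
        by_contra hc
        exact hT (Finset.mem_filter.2 ⟨hr, hrS, not_le.1 hc⟩)
      refine lt_of_le_of_ne hle fun heq => hrS (Finset.mem_filter.2 ⟨hr, ?_⟩)
      rw [heq]
      norm_num
  · rintro _ ⟨⟨S, T⟩, -, rfl⟩
    -- On the star, `f (s • x)` is positive for `s ∈ T` and less than `1` for `s ∉ T`, whether or
    -- not `s ∈ S`.
    refine ⟨_, ⟨fun s => if s ∈ T then A₁ᶜ else A₂ᶜ, fun s _ => ?_, rfl⟩, fun x hx => ?_⟩
    · dsimp only
      split_ifs <;> simp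
    · refine mem_iInter₂.2 fun s hs => ?_
      by_cases hT : s ∈ T
      · simp only [hT, if_true, mem_preimage, mem_compl_iff]
        intro hA
        have h0 := h₁ _ hA
        by_cases hS : s ∈ S
        · linarith [(hx.1 s hS).1]
        · linarith [(hx.2 s hs hS).2.1 hT]
      · simp only [hT, if_false, mem_preimage, mem_compl_iff]
        intro hA
        have h0 := h₂ _ hA
        by_cases hS : s ∈ S
        · linarith [(hx.1 s hS).2]
        · linarith [(hx.2 s hs hS).2.2 hT]
  · let J := I.filter fun p => x ∈ cubeStar f F p.1 p.2
    have hsub : {V ∈ (fun p => cubeStar f F p.1 p.2) '' (I : Set (Finset G × Finset G)) | x ∈ V} ⊆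
        (fun p => cubeStar f F p.1 p.2) '' (J : Set (Finset G × Finset G)) := by
      rintro _ ⟨⟨p, hp, rfl⟩, hx⟩
      exact ⟨p, Finset.mem_coe.2 (Finset.mem_filter.2 ⟨hp, hx⟩), rfl⟩
    calc _ ≤ _ := ncard_le_ncard hsub (J.finite_toSet.image _)
      _ ≤ (J : Set (Finset G × Finset G)).ncard := ncard_image_le J.finite_toSet
      _ = J.card := ncard_coe_finset J
      _ ≤ (Finset.range (k + 1)).card := ?_
      _ = k + 1 := Finset.card_range _
    have hJ : ∀ p ∈ J, p.1 ⊆ F ∧ (∀ r ∈ p.2, r ∈ F ∧ r ∉ p.1) ∧ x ∈ cubeStar f F p.1 p.2 := by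
      intro p hp
      simp only [J, I, Finset.mem_filter, Finset.mem_product, Finset.mem_powerset] at hp
      exact ⟨hp.1.1.1, hp.1.2, hp.2⟩
    refine Finset.card_le_card_of_injOn (fun p => p.1.card) (fun p hp => ?_) fun p hp q hq hpq => ?_
    · obtain ⟨hpF, -, hpx⟩ := hJ p hp
      refine Finset.mem_coe.2 (Finset.mem_range.2 (Nat.lt_succ_of_le (le_trans ?_ (hk x))))
      exact Finset.card_le_card fun s hs => Finset.mem_filter.2 ⟨hpF hs, hpx.1 s hs⟩
    · obtain ⟨hpF, hpT, hpx⟩ := hJ p hp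
      obtain ⟨hqF, hqT, hqx⟩ := hJ q hq
      exact Prod.ext_iff.2 (cubeStar_index_eq_of_card_eq hpF hqF hpT hqT hpx hqx hpq)

end CubeCover

/-! ### Vanishing mean dimension from a small boundary -/

section Separation

variable {G X : Type*} [Group G] [MulAction G X] [MeasurableSpace X]
  [TopologicalSpace X] [CompactSpace X] [TopologicalSpace.MetrizableSpace X] [BorelSpace X]
  [ContinuousConstSMul G X]

/-- An open set with small boundary that separates two closed sets forces the mean dimension of the
complementary cover to vanish. -/
theorem mdimCover_eq_zero {U A₁ A₂ : Set X} (hU : IsOpen U) (hA₁ : IsClosed A₁)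
    (hA₂ : IsClosed A₂) (h₁ : A₁ ⊆ U) (h₂ : Disjoint A₂ (closure U))
    (hnull : ∀ μ ∈ invariantMeasures G X, (μ : Measure X) (frontier U) = 0) :
    mdimCover G ({A₁ᶜ, A₂ᶜ} : Set (Set X)) = 0 := by
  classical
  refine nonpos_iff_eq_zero.1 (le_of_forall_gt_imp_ge_of_dense fun ε hε => ?_)
  -- Keeping `W` off `A₁ ∪ A₂` makes `f` exactly `0` on `A₁` and `1` on `A₂`.
  obtain ⟨W, hW, hEW, hWO, hev⟩ := exists_isOpen_eventually_card_le (G := G) isClosed_frontier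
    (hA₁.union hA₂).isOpen_compl (O := (A₁ ∪ A₂)ᶜ) (E := frontier U) (by
      rintro x hx (hx' | hx')
      · exact (hU.frontier_eq ▸ hx).2 (h₁ hx')
      · exact h₂.notMem_of_mem_left hx' hx.1) hnull hε
  obtain ⟨f, hf0, hf1, hf⟩ := exists_continuous_zero_one_of_isClosed
    (isClosed_closure.sdiff hW : IsClosed (closure U \ W))
    (hU.isClosed_compl.sdiff hW : IsClosed (Uᶜ \ W)) (by
      rw [Set.disjoint_left]
      rintro x ⟨hx, hxW⟩ ⟨hxU, -⟩
      exact hxW (hEW (hU.frontier_eq ▸ ⟨hx, hxU⟩)))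
  have hfW : ∀ x, 0 < f x ∧ f x < 1 → x ∈ W := by
    rintro x ⟨h0, h1⟩
    by_contra hx
    by_cases hxU : x ∈ U
    · exact h0.ne' (hf0 ⟨subset_closure hxU, hx⟩)
    · exact h1.ne (hf1 ⟨hxU, hx⟩)
  have hfA₁ : ∀ x ∈ A₁, f x = 0 := fun x hx =>
    hf0 ⟨subset_closure (h₁ hx), fun hxW => hWO hxW (Or.inl hx)⟩
  have hfA₂ : ∀ x ∈ A₂, f x = 1 := fun x hx =>
    hf1 ⟨fun hxU => h₂.notMem_of_mem_left hx (subset_closure hxU), fun hxW => hWO hxW (Or.inr hx)⟩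
  refine limsup_le_of_le (h := ?_)
  filter_upwards [hev] with F hF
  refine ENNReal.div_le_of_le_mul ?_
  -- The bound `k` must be a natural number uniform in the point: it is the maximal visit count to
  -- `W`, attained at some `x` when `X` is nonempty, where `hF x` applies.
  rcases isEmpty_or_nonempty X with hX | hX
  · refine le_trans (Nat.cast_le.2 (coverDim_joinCover_le f.continuous hfA₁ hfA₂ F
      (k := 0) fun x => hX.elim x)) (by simp)
  let c : X → ℕ := fun x => (F.filter fun s : G => s • x ∈ W).card
  have hbdd : BddAbove (range c) := ⟨F.card, forall_mem_range.2 fun x => Finset.card_filter_le _ _⟩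
  obtain ⟨x, hx⟩ := Nat.sSup_mem (range_nonempty c) hbdd
  refine le_trans (Nat.cast_le.2 (coverDim_joinCover_le f.continuous hfA₁ hfA₂ F (k := c x)
    fun y => ?_)) (hF x)
  refine le_trans (Finset.card_le_card fun s hs => ?_)
    (hx ▸ le_csSup hbdd (mem_range_self y) : c y ≤ c x)
  exact Finset.mem_filter.2 ⟨(Finset.mem_filter.1 hs).1, hfW _ (Finset.mem_filter.1 hs).2⟩

end Separation

end SmallBoundary

theorem theorem4p4 {G X : Type*} [Group G] [Countable G] [Infinite G]
    [TopologicalSpace X] [CompactSpace X] [TopologicalSpace.MetrizableSpace X]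
    [MeasurableSpace X] [BorelSpace X] [MulAction G X] [ContinuousConstSMul G X]
    (hG : SmallBoundary.IsAmenable G) (x₁ x₂ : X)
    (h : SmallBoundary.IsMeanDimensionPair G x₁ x₂) :
    SmallBoundary.IsSBPPair G x₁ x₂ := by
  refine ⟨h.1, ?_⟩
  rintro ⟨U, hU, hx₁, hx₂, -, hnull⟩
  have hnull' : ∀ μ ∈ SmallBoundary.invariantMeasures G X,
      (μ : Measure X) (frontier U) = 0 := by
    simpa only [ENNReal.iSup_eq_zero] using hnull
  obtain ⟨A₁, hA₁, hA₁c, hA₁U⟩ := exists_mem_nhds_isClosed_subset (hU.mem_nhds hx₁)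
  obtain ⟨A₂, hA₂, hA₂c, hA₂U⟩ :=
    exists_mem_nhds_isClosed_subset (isClosed_closure.isOpen_compl.mem_nhds hx₂)
  have hd : Disjoint A₂ (closure U) := disjoint_left.2 hA₂U
  have hpos := h.2 A₁ A₂ hA₁c hA₂c hA₁ hA₂ (hd.mono_right (hA₁U.trans subset_closure)).symm
  exact hpos.ne' (SmallBoundary.mdimCover_eq_zero hU hA₁c hA₂c hA₁U hd hnull')
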